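/- Let $k$ be an algebraically closed field of characteristic zero. A variety over $k$ is an integral separated scheme of finite type over $k$. A variety $X$ over $k$ is called geometrically-special over $k$ if, for every dense open subset $U\subset X$, there exist a smooth quasi-projective connected curve $C$ over $k$, a point $c\in C(k)$, a point $u\in U(k)$, and a sequence of morphisms $f_i\colon C\to X$ over $k$ ($i=1,2,\ldots$) with $f_i(c)=u$ for all $i$ such that the closure of $\bigcup_{i\ge 1}\Gamma_{f_i}$ in $C\times_k X$ equals $C\times_k X$, where $\Gamma_{f_i}\subset C\times_k X$ denotes the graph of $f_i$. Lemma. Let $X$ and $Y$ be geometrically-special varieties over $k$. Then $X\times_k Y$ is a geometrically-special variety over $k$. -/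

import Mathlib

open CategoryTheory CategoryTheory.Limits AlgebraicGeometry

namespace GeomSpecial

universe u

/-- A *variety* over the field `k`: a scheme `X`, with structure morphism `f : X ⟶ Spec k`, that is
integral, separated over `k` and of finite type over `k` (finite type means locally of finite type
and quasi-compact). -/
structure IsVariety {k : Type u} [Field k] {X : Scheme.{u}} (f : X ⟶ Spec (CommRingCat.of k)) :
    Prop where
  integral : IsIntegral X
  separated : IsSeparated f
  locallyOfFiniteType : LocallyOfFiniteType f
  quasiCompact : QuasiCompact f

attribute [local instance] MvPolynomial.gradedAlgebra

/-- Projective `n`-space over `k`, as `Proj k[x₀, …, xₙ]`. -/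
noncomputable def ProjSpace (n : ℕ) (k : Type u) [Field k] : Scheme.{u} :=
  Proj (MvPolynomial.homogeneousSubmodule (Fin (n + 1)) k)

/-- The structure morphism of projective `n`-space over `k`. -/
noncomputable def ProjSpace.toSpec (n : ℕ) (k : Type u) [Field k] :
    ProjSpace n k ⟶ Spec (CommRingCat.of k) :=
  Proj.toSpecZero (MvPolynomial.homogeneousSubmodule (Fin (n + 1)) k) ≫
    Spec.map (CommRingCat.ofHom
      (algebraMap k (MvPolynomial.homogeneousSubmodule (Fin (n + 1)) k 0)))

/-- `X` is *quasi-projective* over `k`: it admits a (locally closed) immersion over `k` into some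
projective space over `k`. -/
def IsQuasiProjective {k : Type u} [Field k] {X : Scheme.{u}} (f : X ⟶ Spec (CommRingCat.of k)) :
    Prop :=
  ∃ (n : ℕ) (j : X ⟶ ProjSpace n k), IsImmersion j ∧ j ≫ ProjSpace.toSpec n k = f

/-- A *smooth quasi-projective connected curve* over `k`: a connected, separated scheme of finite
type over `k` that is quasi-projective and smooth of relative dimension one over `k`, i.e. smooth
and pure of dimension one. (Being smooth and connected, such a scheme is integral.) -/
structure IsSmoothQuasiProjectiveConnectedCurve {k : Type u} [Field k] {C : Scheme.{u}}
    (p : C ⟶ Spec (CommRingCat.of k)) : Prop where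
  connected : ConnectedSpace C
  separated : IsSeparated p
  locallyOfFiniteType : LocallyOfFiniteType p
  quasiCompact : QuasiCompact p
  quasiProjective : IsQuasiProjective p
  smooth : SmoothOfRelativeDimension 1 p

/-- The set `X(k)` of `k`-rational points of `X`: the sections over `k` of the structure morphism
`f : X ⟶ Spec k`. -/
def RatPoint {k : Type u} [Field k] {X : Scheme.{u}} (f : X ⟶ Spec (CommRingCat.of k)) : Type u :=
  {x : Spec (CommRingCat.of k) ⟶ X // x ≫ f = 𝟙 _}

/-- The set of morphisms `C ⟶ X` over `k`. -/
def HomOver {k : Type u} [Field k] {C X : Scheme.{u}} (p : C ⟶ Spec (CommRingCat.of k))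
    (f : X ⟶ Spec (CommRingCat.of k)) : Type u :=
  {φ : C ⟶ X // φ ≫ f = p}

/-- The graph `Γ_φ ⊆ C × X` of a morphism `φ : C ⟶ X` over `k`, as a set of points of the fibre
product `C × X` over `k`: the image of `(id, φ) : C ⟶ C × X`. -/
noncomputable def graph {k : Type u} [Field k] {C X : Scheme.{u}}
    {p : C ⟶ Spec (CommRingCat.of k)} {f : X ⟶ Spec (CommRingCat.of k)} (φ : HomOver p f) :
    Set ↥(pullback p f) :=
  Set.range (pullback.lift (𝟙 C) φ.1 (by rw [φ.2, Category.id_comp]) : C ⟶ pullback p f)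

/-- The scheme `X` over `k` (meant for varieties) is *geometrically-special over `k`*: for every
dense open `U ⊆ X` there are a smooth quasi-projective connected curve `C` over `k`, points
`c ∈ C(k)` and `u ∈ U(k)`, and a sequence of morphisms `φᵢ : C ⟶ X` over `k` with `φᵢ(c) = u` such
that the closure of the union of the graphs of the `φᵢ` is all of `C × X`. -/
def IsGeometricallySpecial {k : Type u} [Field k] {X : Scheme.{u}}
    (f : X ⟶ Spec (CommRingCat.of k)) : Prop :=
  ∀ U : X.Opens, Dense (U : Set X) →
    ∃ (C : Scheme.{u}) (p : C ⟶ Spec (CommRingCat.of k)) (c : RatPoint p) (u : RatPoint f)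
      (φ : ℕ → HomOver p f),
      IsSmoothQuasiProjectiveConnectedCurve p ∧
      Set.range u.1 ⊆ (U : Set X) ∧
      (∀ i, c.1 ≫ (φ i).1 = u.1) ∧
      closure (⋃ i, graph (φ i)) = Set.univ

end GeomSpecial

open scoped TensorProduct

universe u

/-! Integrality of the product comes from the density of rational points over an algebraically
closed field. For the special property, let `U` be dense open in `X × Y`. Its projection to `X` is
dense open and yields a curve `C` with maps `φᵢ` through some `u`. The fibre of `U` over `u` is a
nonempty, hence dense, open of `Y`, and yields a curve `D` with maps `ψⱼ`. The two curves are
replaced by one curve `E`, étale over both, with a point above both base points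
(`exists_curve_etale_over`). Density of the graphs survives pullback to `E` because étale maps are
universally open. All pairs `(φᵢ, ψⱼ)` then have dense graphs in `E × (X × Y)`
(`dense_iUnion_graph_prod`). -/

/-! ### Integrality of products over an algebraically closed field -/

theorem isReduced_tensorProduct_of_isAlgClosed (k A B : Type*) [Field k] [IsAlgClosed k]
    [CommRing A] [CommRing B] [Algebra k A] [Algebra k B] [Algebra.FiniteType k A]
    [IsReduced A] [IsReduced B] : IsReduced (A ⊗[k] B) := by
  have : IsJacobsonRing A := isJacobsonRing_of_finiteType (A := k)
  let b := Module.Basis.ofVectorSpace k B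
  let b' := b.baseChange A
  refine ⟨fun u hu ↦ b'.ext_elem fun i ↦ ?_⟩
  rw [map_zero, Finsupp.zero_apply]
  have hjac : Ideal.jacobson (⊥ : Ideal A) = ⊥ := by
    exact IsJacobsonRing.out inferInstance (Ideal.isRadical_bot)
  -- A coordinate vanishes once it vanishes at every maximal ideal. Each residue field is `k`, and
  -- specialising there sends the nilpotent `u` into the reduced ring `B`.
  rw [← Ideal.mem_bot, ← hjac, Ideal.jacobson, Ideal.mem_sInf]
  rintro m ⟨-, hm⟩
  have hmax : m.IsMaximal := hm
  let _ := Ideal.Quotient.field m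
  have hfin : Module.Finite k (A ⧸ m) := finite_of_finite_type_of_isJacobsonRing k (A ⧸ m)
  have hbij := IsAlgClosed.algebraMap_bijective_of_isIntegral (k := k) (K := A ⧸ m)
  let e : (A ⧸ m) ≃ₐ[k] k := (AlgEquiv.ofBijective (Algebra.ofId k (A ⧸ m)) hbij).symm
  let χ : A →ₐ[k] k := e.toAlgHom.comp (Ideal.Quotient.mkₐ k m)
  let φ : A ⊗[k] B →ₐ[k] B :=
    (Algebra.TensorProduct.lid k B).toAlgHom.comp (Algebra.TensorProduct.map χ (AlgHom.id k B))
  have hcoord (v : A ⊗[k] B) : b.repr (φ v) i = χ (b'.repr v i) := by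
    induction v with
    | zero => simp
    | add x y hx hy => simp [hx, hy]
    | tmul x y => simp [φ, b', mul_comm]
  have h0 : φ u = 0 := (hu.map φ).eq_zero
  have h1 : χ (b'.repr u i) = 0 := by rw [← hcoord, h0]; simp
  have h2 : e (Ideal.Quotient.mk m (b'.repr u i)) = 0 := h1
  rwa [map_eq_zero_iff e e.injective, Ideal.Quotient.eq_zero_iff_mem] at h2

namespace AlgebraicGeometry

variable {k : Type u} [Field k] {X Y : Scheme.{u}}

theorem isReduced_pullback_Spec_of_isAlgClosed [IsAlgClosed k] {A B : CommRingCat.{u}}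
    (f : Spec A ⟶ Spec (.of k)) (g : Spec B ⟶ Spec (.of k)) [LocallyOfFiniteType f]
    [IsReduced (Spec A)] [IsReduced (Spec B)] : IsReduced (pullback f g) := by
  obtain ⟨φ, rfl⟩ := Spec.map_surjective f
  obtain ⟨ψ, rfl⟩ := Spec.map_surjective g
  let _ : Algebra k A := φ.hom.toAlgebra
  let _ : Algebra k B := ψ.hom.toAlgebra
  have : _root_.IsReduced A := (affine_isReduced_iff A).mp inferInstance
  have : _root_.IsReduced B := (affine_isReduced_iff B).mp inferInstance
  have : Algebra.FiniteType k A :=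
    (HasRingHomProperty.Spec_iff (P := @LocallyOfFiniteType) (φ := φ)).mp inferInstance
  have := isReduced_tensorProduct_of_isAlgClosed k A B
  have : IsReduced (Spec (.of (A ⊗[k] B))) := (affine_isReduced_iff _).mpr this
  exact isReduced_of_isOpenImmersion (pullbackSpecIso k A B).hom

theorem isReduced_pullback_of_isAlgClosed [IsAlgClosed k] (f : X ⟶ Spec (.of k))
    (g : Y ⟶ Spec (.of k)) [LocallyOfFiniteType f] [IsReduced X] [IsReduced Y] :
    IsReduced (pullback f g) := by
  refine @IsReduced.of_openCover _
    (Scheme.Pullback.openCoverOfLeftRight X.affineCover Y.affineCover f g) ?_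
  rintro ⟨i, j⟩
  have hX : IsReduced (X.affineCover.X i) := isReduced_of_isOpenImmersion (X.affineCover.f i)
  have hY : IsReduced (Y.affineCover.X j) := isReduced_of_isOpenImmersion (Y.affineCover.f j)
  have hf : LocallyOfFiniteType (X.affineCover.f i ≫ f) :=
    MorphismProperty.comp_mem _ _ _ inferInstance inferInstance
  exact @isReduced_pullback_Spec_of_isAlgClosed _ _ _ _ _ (X.affineCover.f i ≫ f)
    (Y.affineCover.f j ≫ g) hf hX hY

theorem exists_ratPoint_mem [IsAlgClosed k] (f : X ⟶ Spec (.of k)) [LocallyOfFiniteType f]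
    (U : X.Opens) (hU : (U : Set X).Nonempty) :
    ∃ u : GeomSpecial.RatPoint f, Set.range u.1 ⊆ (U : Set X) := by
  have : JacobsonSpace X := LocallyOfFiniteType.jacobsonSpace f
  obtain ⟨x, hxU, hx⟩ := nonempty_inter_closedPoints hU U.isOpen.isLocallyClosed
  refine ⟨⟨pointOfClosedPoint f x hx, pointOfClosedPoint_comp f x hx⟩, ?_⟩
  rintro _ ⟨a, rfl⟩
  exact (pointOfClosedPoint_apply f x hx a).symm ▸ hxU

/-- The inclusion of the fibre `{u} × Y` over a rational point `u` of `X`. -/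
noncomputable def slice (f : X ⟶ Spec (.of k)) (g : Y ⟶ Spec (.of k))
    (u : GeomSpecial.RatPoint f) : Y ⟶ pullback f g :=
  pullback.lift (g ≫ u.1) (𝟙 Y) (by simp [u.2])

theorem exists_slice_apply_eq (f : X ⟶ Spec (.of k)) (g : Y ⟶ Spec (.of k))
    (u : GeomSpecial.RatPoint f) (z : ↥(pullback f g))
    (hz : pullback.fst f g z ∈ Set.range u.1) : ∃ y, slice f g u y = z := by
  obtain ⟨a, ha⟩ := hz
  have h : IsPullback (slice f g u) g (pullback.fst f g) u.1 := by
    refine IsPullback.of_right (h₁₂ := pullback.snd f g) (v₁₃ := g) (h₂₂ := f) ?_ ?_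
      (IsPullback.of_hasPullback f g).flip
    · have h1 : slice f g u ≫ pullback.snd f g = 𝟙 Y := pullback.lift_snd _ _ _
      rw [u.2, h1]
      exact IsPullback.of_horiz_isIso ⟨by simp⟩
    · exact pullback.lift_fst _ _ _
  obtain ⟨y, hy, -⟩ := Scheme.exists_preimage_of_isPullback h z a ha.symm
  exact ⟨y, hy⟩

/-- The projections of two nonempty opens meet, and their intersection contains a rational point
`u`. Both opens then meet the slice `{u} × Y`, a copy of the irreducible `Y`. -/
theorem irreducibleSpace_pullback_of_isAlgClosed [IsAlgClosed k] (f : X ⟶ Spec (.of k))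
    (g : Y ⟶ Spec (.of k)) [LocallyOfFiniteType f] [IrreducibleSpace X] [IrreducibleSpace Y] :
    IrreducibleSpace ↥(pullback f g) := by
  have hopen : IsOpenMap (pullback.fst f g) := (pullback.fst f g).isOpenMap
  have hne : Nonempty ↥(pullback f g) := by
    obtain ⟨z, -⟩ := Scheme.Pullback.exists_preimage_pullback (f := f) (g := g)
      (Nonempty.some inferInstance) (Nonempty.some inferInstance) (Subsingleton.elim _ _)
    exact ⟨z⟩
  refine { isPreirreducible_univ := ?_, toNonempty := hne }
  rintro V W hV hW ⟨v, -, hv⟩ ⟨w, -, hw⟩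
  obtain ⟨x, hx⟩ := nonempty_preirreducible_inter (hopen V hV) (hopen W hW)
    ⟨_, v, hv, rfl⟩ ⟨_, w, hw, rfl⟩
  obtain ⟨u, hu⟩ := exists_ratPoint_mem f ⟨_, (hopen V hV).inter (hopen W hW)⟩ ⟨x, hx⟩
  obtain ⟨a⟩ : Nonempty (Spec (CommRingCat.of k)) := inferInstance
  obtain ⟨⟨v', hv', hva⟩, ⟨w', hw', hwa⟩⟩ := hu ⟨a, rfl⟩
  obtain ⟨y, rfl⟩ := exists_slice_apply_eq f g u v' ⟨a, hva.symm⟩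
  obtain ⟨y', rfl⟩ := exists_slice_apply_eq f g u w' ⟨a, hwa.symm⟩
  obtain ⟨z, hz, hz'⟩ := nonempty_preirreducible_inter
    (hV.preimage (slice f g u).continuous) (hW.preimage (slice f g u).continuous)
    ⟨y, hv'⟩ ⟨y', hw'⟩
  exact ⟨slice f g u z, trivial, hz, hz'⟩

end AlgebraicGeometry

theorem GeomSpecial.IsVariety.pullback {k : Type u} [Field k] [IsAlgClosed k] {X Y : Scheme.{u}}
    {f : X ⟶ Spec (.of k)} {g : Y ⟶ Spec (.of k)} (hX : GeomSpecial.IsVariety f)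
    (hY : GeomSpecial.IsVariety g) : GeomSpecial.IsVariety (pullback.fst f g ≫ f) := by
  obtain ⟨_, _, _, _⟩ := hX
  obtain ⟨_, _, _, _⟩ := hY
  refine ⟨?_, inferInstance, inferInstance, inferInstance⟩
  rw [isIntegral_iff_irreducibleSpace_and_isReduced]
  exact ⟨irreducibleSpace_pullback_of_isAlgClosed f g, isReduced_pullback_of_isAlgClosed f g⟩

/-! ### Affine schemes of finite type are quasi-projective -/

namespace GeomSpecial

attribute [local instance] MvPolynomial.gradedAlgebra

/-- Dehomogenisation: sending `x₀` to 1 and the other variables to generators of `A` embeds `Spec A`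
as a closed subscheme of the chart `x₀ ≠ 0`. -/
theorem exists_away_surjective {k A : Type*} [Field k] [CommRing A] [Algebra k A]
    [Algebra.FiniteType k A] :
    ∃ (n : ℕ) (θ : HomogeneousLocalization.Away (MvPolynomial.homogeneousSubmodule (Fin (n + 1)) k)
      (MvPolynomial.X 0) →+* A), Function.Surjective θ ∧
      ∀ r : k, θ (HomogeneousLocalization.fromZeroRingHom _ _ (algebraMap k
        (MvPolynomial.homogeneousSubmodule (Fin (n + 1)) k 0) r)) = algebraMap k A r := by
  obtain ⟨n, π, hπ⟩ := Algebra.FiniteType.iff_quotient_mvPolynomial''.mp ‹Algebra.FiniteType k A›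
  let 𝒜 := MvPolynomial.homogeneousSubmodule (Fin (n + 1)) k
  let ev : MvPolynomial (Fin (n + 1)) k →ₐ[k] A :=
    MvPolynomial.aeval (Fin.cons 1 fun i ↦ π (MvPolynomial.X i))
  have h1 : ev (MvPolynomial.X 0) = 1 := by simp [ev]
  let L : Localization.Away (MvPolynomial.X 0 : MvPolynomial (Fin (n + 1)) k) →+* A :=
    IsLocalization.Away.lift (MvPolynomial.X 0) (g := ev.toRingHom) (by
      change IsUnit (ev _); rw [h1]; exact isUnit_one)
  let θ : HomogeneousLocalization.Away 𝒜 (MvPolynomial.X 0) →+* A :=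
    L.comp (algebraMap _ _)
  have hL (p) : L (algebraMap _ _ p) = ev p := IsLocalization.Away.lift_eq _ _ _
  have hmk (p s) : L (Localization.mk p s) * ev s = ev p := by
    rw [← hL, ← hL, ← map_mul, Localization.mk_eq_mk', IsLocalization.mk'_spec]
  have hC (r : k) : θ (HomogeneousLocalization.fromZeroRingHom _ _ (algebraMap k (𝒜 0) r)) =
      algebraMap k A r :=
    (mul_one _).symm.trans <| (congrArg _ (map_one ev).symm).trans <|
      (hmk (MvPolynomial.C r) 1).trans (ev.commutes r)
  have hX0 : (MvPolynomial.X 0 : MvPolynomial (Fin (n + 1)) k) ∈ 𝒜 1 :=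
    MvPolynomial.isHomogeneous_X k 0
  have hXi (i : Fin n) : θ (HomogeneousLocalization.Away.mk 𝒜 hX0 1 (MvPolynomial.X i.succ)
      (MvPolynomial.isHomogeneous_X k _)) = π (MvPolynomial.X i) := by
    have h2 := hmk (MvPolynomial.X i.succ) ⟨MvPolynomial.X 0 ^ 1, 1, rfl⟩
    have h3 : ev (MvPolynomial.X i.succ) = π (MvPolynomial.X i) := by simp [ev]
    have h4 : ev (MvPolynomial.X 0 ^ 1) = 1 := by rw [pow_one, h1]
    rw [h3] at h2
    exact (mul_one _).symm.trans <| (congrArg _ h4.symm).trans h2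
  refine ⟨n, θ, ?_, hC⟩
  intro a
  obtain ⟨p, rfl⟩ := hπ a
  change π p ∈ θ.range
  induction p using MvPolynomial.induction_on with
  | C r => exact ⟨_, (hC r).trans (π.commutes r).symm⟩
  | add p q hp hq => rw [map_add]; exact add_mem hp hq
  | mul_X p i hp => rw [map_mul]; exact mul_mem hp ⟨_, hXi i⟩

theorem exists_isImmersion_Proj {k R A : Type u} [Field k] [CommRing R] [Algebra k R]
    [CommRing A] [Algebra k A] (𝒜 : ℕ → Submodule k R) [GradedAlgebra 𝒜] {x : R} (hx : x ∈ 𝒜 1)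
    (θ : HomogeneousLocalization.Away 𝒜 x →+* A) (hθ : Function.Surjective θ)
    (hk : ∀ r : k, θ (HomogeneousLocalization.fromZeroRingHom _ _ (algebraMap k (𝒜 0) r)) =
      algebraMap k A r) :
    ∃ j : Spec (.of A) ⟶ Proj 𝒜, IsImmersion j ∧
      j ≫ Proj.toSpecZero 𝒜 ≫ Spec.map (CommRingCat.ofHom (algebraMap k (𝒜 0))) =
        Spec.map (CommRingCat.ofHom (algebraMap k A)) := by
  have : IsClosedImmersion (Spec.map (CommRingCat.ofHom θ)) :=
    IsClosedImmersion.spec_of_surjective _ hθ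
  refine ⟨Spec.map (CommRingCat.ofHom θ) ≫ Proj.awayι 𝒜 x hx one_pos, inferInstance, ?_⟩
  rw [Category.assoc, Proj.awayι_toSpecZero_assoc, ← Spec.map_comp, ← Spec.map_comp]
  congr 1
  ext r
  exact hk r

theorem isQuasiProjective_of_isAffine {k : Type u} [Field k] {X : Scheme.{u}} [IsAffine X]
    (f : X ⟶ Spec (.of k)) [LocallyOfFiniteType f] : IsQuasiProjective f := by
  obtain ⟨φ, hφ⟩ := Spec.map_surjective (X.isoSpec.inv ≫ f)
  let _ : Algebra k Γ(X, ⊤) := φ.hom.toAlgebra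
  have : Algebra.FiniteType k Γ(X, ⊤) :=
    (HasRingHomProperty.Spec_iff (P := @LocallyOfFiniteType)).mp
      (by rw [hφ]; infer_instance : LocallyOfFiniteType (Spec.map φ))
  obtain ⟨n, θ, hθ, hk⟩ := exists_away_surjective (k := k) (A := Γ(X, ⊤))
  obtain ⟨j, hj, hjk⟩ := exists_isImmersion_Proj
    (MvPolynomial.homogeneousSubmodule (Fin (n + 1)) k) (MvPolynomial.isHomogeneous_X k 0) θ hθ hk
  refine ⟨n, X.isoSpec.hom ≫ j, @IsImmersion.comp _ _ _ _ _ inferInstance hj, ?_⟩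
  have h : j ≫ ProjSpace.toSpec n k = X.isoSpec.inv ≫ f := hjk.trans hφ
  exact (Category.assoc _ _ _).trans ((Iso.eq_inv_comp _).1 h)

end GeomSpecial

/-! ### Étale coordinates and a common étale cover of two pointed curves -/

namespace GeomSpecial

/-- The automorphism `x ↦ x - a` of the polynomial ring in one variable. -/
noncomputable def translate (k : Type*) [CommRing k] (a : k) :
    MvPolynomial (Fin 1) k ≃ₐ[k] MvPolynomial (Fin 1) k :=
  AlgEquiv.ofAlgHom (MvPolynomial.aeval fun i ↦ MvPolynomial.X i - MvPolynomial.C a)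
    (MvPolynomial.aeval fun i ↦ MvPolynomial.X i + MvPolynomial.C a)
    (by ext; simp) (by ext; simp)

variable {k : Type u} [Field k]

theorem exists_etale_coordinate {C : Scheme.{u}} (p : C ⟶ Spec (.of k))
    [SmoothOfRelativeDimension 1 p] (c : RatPoint p) :
    ∃ (A : CommRingCat.{u}) (j : Spec A ⟶ C) (t : Spec A ⟶ Spec (.of (MvPolynomial (Fin 1) k)))
      (c' : Spec (.of k) ⟶ Spec A), IsOpenImmersion j ∧ Etale t ∧
      t ≫ Spec.map (CommRingCat.ofHom MvPolynomial.C) = j ≫ p ∧ c' ≫ j = c.1 ∧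
      c' ≫ t = Spec.map (CommRingCat.ofHom (MvPolynomial.eval (0 : Fin 1 → k))) := by
  obtain ⟨a⟩ : Nonempty (Spec (CommRingCat.of k)) := inferInstance
  obtain ⟨U, hU, V, hV, hx, e, hsm⟩ :=
    SmoothOfRelativeDimension.exists_isStandardSmoothOfRelativeDimension (n := 1) (f := p) (c.1 a)
  obtain rfl : U = ⊤ := by
    ext b
    have : b = p (c.1 a) := Subsingleton.elim _ _
    simpa [this] using e hx
  let φ : CommRingCat.of k ⟶ Γ(C, V) := (Scheme.ΓSpecIso (.of k)).inv ≫ p.appLE ⊤ V e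
  have hφ : φ.hom.IsStandardSmoothOfRelativeDimension 1 := by
    exact RingHom.isStandardSmoothOfRelativeDimension_respectsIso.2 _
      (Scheme.ΓSpecIso (.of k)).symm.commRingCatIsoToRingEquiv hsm
  obtain ⟨g, hg, hget⟩ := hφ.exists_etale_mvPolynomial
  have hj : Spec.map φ = hV.fromSpec ≫ p := by
    rw [← hU.SpecMap_appLE_fromSpec p hV e, Spec.map_comp, IsAffineOpen.fromSpec_top]
    congr 1
    simp [Scheme.isoSpec_Spec_inv]
  have hrange : Set.range c.1 ⊆ Set.range hV.fromSpec := by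
    rw [hV.range_fromSpec]
    rintro _ ⟨b, rfl⟩
    rwa [Subsingleton.elim b a]
  let c' := IsOpenImmersion.lift hV.fromSpec c.1 hrange
  have hc' : c' ≫ hV.fromSpec = c.1 := IsOpenImmersion.lift_fac _ _ _
  obtain ⟨χ, hχ⟩ := Spec.map_surjective c'
  have hχφ : φ ≫ χ = 𝟙 _ := by
    apply Spec.map_injective
    rw [Spec.map_comp, hχ, hj, reassoc_of% hc', c.2, Spec.map_id]
  -- Subtracting the value of the coordinate at `c` moves the image of `c` to the origin.
  let τ := translate k (χ.hom (g (MvPolynomial.X 0)))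
  have hτet : (g.comp τ.toRingEquiv.toRingHom).Etale := by
    exact RingHom.Etale.respectsIso.2 _ τ.toRingEquiv hget
  refine ⟨_, hV.fromSpec, Spec.map (CommRingCat.ofHom (g.comp τ.toRingEquiv.toRingHom)), c',
    inferInstance, ?_, ?_, hc', ?_⟩
  · rwa [HasRingHomProperty.Spec_iff (P := @Etale)]
  · rw [← hj, ← Spec.map_comp]
    congr 1
    ext r
    change g (τ (MvPolynomial.C r)) = φ.hom r
    rw [← hg]
    have : τ (MvPolynomial.C r) = MvPolynomial.C r := τ.commutes r
    rw [this]; rfl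
  · rw [← hχ, ← Spec.map_comp]
    congr 1
    have hk (r : k) : χ.hom (g (MvPolynomial.C r)) = r := by
      have h1 : g (MvPolynomial.C r) = φ.hom r := by rw [← hg]; rfl
      rw [h1]
      exact congr($hχφ r)
    have hC (r : k) : τ (MvPolynomial.C r) = MvPolynomial.C r := τ.commutes r
    ext r
    · change χ.hom (g (τ (MvPolynomial.C r))) = _
      rw [hC, hk]; simp
    · rename_i i
      obtain rfl : r = 0 := Subsingleton.elim _ _
      change χ.hom (g (τ (MvPolynomial.X 0))) = _
      simp [τ, translate, hk]

end GeomSpecial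

theorem TopologicalSpace.NoetherianSpace.isOpen_connectedComponent {α : Type*}
    [TopologicalSpace α] [TopologicalSpace.NoetherianSpace α] (x : α) :
    IsOpen (connectedComponent x) := by
  have h : (connectedComponent x)ᶜ =
      ⋃₀ {Z ∈ irreducibleComponents α | Disjoint Z (connectedComponent x)} := by
    ext y
    constructor
    · intro hy
      refine ⟨irreducibleComponent y, ⟨irreducibleComponent_mem_irreducibleComponents y, ?_⟩,
        mem_irreducibleComponent⟩
      rw [Set.disjoint_left]
      intro z hz hzx
      apply hy
      rw [connectedComponent_eq hzx]
      exact isIrreducible_irreducibleComponent.isConnected.isPreconnected.subset_connectedComponent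
        hz mem_irreducibleComponent
    · rintro ⟨Z, ⟨-, hZ⟩, hy⟩
      exact Set.disjoint_left.1 hZ hy
  rw [← isClosed_compl_iff, h]
  rw [Set.sUnion_eq_biUnion]
  exact Set.Finite.isClosed_biUnion
    (TopologicalSpace.NoetherianSpace.finite_irreducibleComponents.subset fun Z hZ ↦ hZ.1)
    fun Z hZ ↦ isClosed_of_mem_irreducibleComponents Z hZ.1

theorem AlgebraicGeometry.IsClosedImmersion.opens_ι {E : Scheme.{u}} (U : E.Opens)
    (hU : IsClosed (U : Set E)) : IsClosedImmersion U.ι :=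
  .of_isPreimmersion _ (by rwa [Scheme.Opens.range_ι])

namespace GeomSpecial

variable {k : Type u} [Field k]

/-- The connected component of the point is open because `E` is noetherian, and closed, hence affine
and so quasi-projective. -/
theorem exists_curve_of_isAffine {E : Scheme.{u}} [IsAffine E] (p : E ⟶ Spec (.of k))
    [SmoothOfRelativeDimension 1 p] [LocallyOfFiniteType p] (e : RatPoint p) :
    ∃ (U : E.Opens) (e' : RatPoint (U.ι ≫ p)), e'.1 ≫ U.ι = e.1 ∧
      IsSmoothQuasiProjectiveConnectedCurve (U.ι ≫ p) := by
  have : IsLocallyNoetherian E := LocallyOfFiniteType.isLocallyNoetherian p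
  have : IsNoetherian E := {}
  obtain ⟨a⟩ : Nonempty (Spec (CommRingCat.of k)) := inferInstance
  let U : E.Opens :=
    ⟨_, TopologicalSpace.NoetherianSpace.isOpen_connectedComponent (e.1 a)⟩
  have : IsClosedImmersion U.ι := .opens_ι U isClosed_connectedComponent
  have : IsAffine U := isAffine_of_isAffineHom U.ι
  have hconn : ConnectedSpace U :=
    isConnected_iff_connectedSpace.mp (isConnected_connectedComponent (x := e.1 a))
  have hr : Set.range e.1 ⊆ Set.range U.ι := by
    rw [Scheme.Opens.range_ι]
    rintro _ ⟨b, rfl⟩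
    rw [Subsingleton.elim b a]
    exact mem_connectedComponent
  have he : IsOpenImmersion.lift U.ι e.1 hr ≫ U.ι = e.1 := IsOpenImmersion.lift_fac _ _ _
  have hsm : SmoothOfRelativeDimension (0 + 1) (U.ι ≫ p) := inferInstance
  exact ⟨U, ⟨IsOpenImmersion.lift U.ι e.1 hr, by rw [reassoc_of% he, e.2]⟩, he, hconn,
    inferInstance, inferInstance, inferInstance, isQuasiProjective_of_isAffine _, hsm⟩

/-- Étale coordinates send both `c` and `d` to the origin of the affine line, so the fibre product
over the line has a rational point above both. `E` is its component through that point. -/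
theorem exists_curve_etale_over {C D : Scheme.{u}} (p : C ⟶ Spec (.of k)) (q : D ⟶ Spec (.of k))
    [SmoothOfRelativeDimension 1 p] [SmoothOfRelativeDimension 1 q] (c : RatPoint p)
    (d : RatPoint q) :
    ∃ (E : Scheme.{u}) (r : E ⟶ Spec (.of k)) (e : RatPoint r) (α : HomOver r p) (β : HomOver r q),
      IsSmoothQuasiProjectiveConnectedCurve r ∧ Etale α.1 ∧ Etale β.1 ∧
      e.1 ≫ α.1 = c.1 ∧ e.1 ≫ β.1 = d.1 := by
  obtain ⟨A, j, t, c', _, _, ht, hc, hct⟩ := exists_etale_coordinate p c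
  obtain ⟨B, j', t', d', _, _, ht', hd, hdt⟩ := exists_etale_coordinate q d
  let E := pullback t t'
  let π₁ : E ⟶ C := pullback.fst t t' ≫ j
  let π₂ : E ⟶ D := pullback.snd t t' ≫ j'
  have h : π₁ ≫ p = π₂ ≫ q := by
    simp only [π₁, π₂, Category.assoc, ← ht, ← ht', pullback.condition_assoc]
  have h₁ : Etale π₁ := inferInstanceAs (Etale (_ ≫ _))
  have h₂ : Etale π₂ := inferInstanceAs (Etale (_ ≫ _))
  let e₀ : Spec (.of k) ⟶ E := pullback.lift c' d' (hct.trans hdt.symm)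
  have he₁ : e₀ ≫ π₁ = c.1 := (pullback.lift_fst_assoc _ _ _ _).trans hc
  have he₂ : e₀ ≫ π₂ = d.1 := (pullback.lift_snd_assoc _ _ _ _).trans hd
  have : SmoothOfRelativeDimension 1 (π₁ ≫ p) :=
    inferInstanceAs (SmoothOfRelativeDimension (0 + 1) (π₁ ≫ p))
  have : Smooth p := SmoothOfRelativeDimension.smooth 1 p
  have : LocallyOfFiniteType (π₁ ≫ p) := inferInstance
  obtain ⟨U, e, he, hU⟩ := exists_curve_of_isAffine (π₁ ≫ p)
    ⟨e₀, by rw [reassoc_of% he₁, c.2]⟩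
  refine ⟨U, U.ι ≫ π₁ ≫ p, e, ⟨U.ι ≫ π₁, by simp⟩, ⟨U.ι ≫ π₂, by simp [h]⟩, hU,
    inferInstance, inferInstance, ?_, ?_⟩
  · rw [reassoc_of% he, he₁]
  · rw [reassoc_of% he, he₂]

end GeomSpecial

/-! ### Density of graphs under pullback and products -/

namespace GeomSpecial

variable {k : Type u} [Field k] {C E X Y : Scheme.{u}} {p : C ⟶ Spec (.of k)}
  {r : E ⟶ Spec (.of k)} {f : X ⟶ Spec (.of k)} {g : Y ⟶ Spec (.of k)}

attribute [local simp] pullback.lift_fst pullback.lift_snd pullback.lift_fst_assoc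
  pullback.lift_snd_assoc

/-- Composition of morphisms over `k`. -/
noncomputable def HomOver.comp (α : HomOver r p) (φ : HomOver p f) : HomOver r f :=
  ⟨α.1 ≫ φ.1, by rw [Category.assoc, φ.2, α.2]⟩

/-- The morphism to a fibre product over `k` with given components. -/
noncomputable def HomOver.prod (φ : HomOver r f) (ψ : HomOver r g) :
    HomOver r (pullback.fst f g ≫ f) :=
  ⟨pullback.lift φ.1 ψ.1 (φ.2.trans ψ.2.symm), by rw [pullback.lift_fst_assoc, φ.2]⟩

/-- The map `(id, φ) : C ⟶ C × X`. -/
noncomputable abbrev graphHom (φ : C ⟶ X) (hφ : φ ≫ f = p) : C ⟶ pullback p f :=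
  pullback.lift (𝟙 C) φ (by rw [hφ, Category.id_comp])

/-- The base change `α × X : E × X ⟶ C × X`. -/
noncomputable abbrev baseChange (α : E ⟶ C) (hα : α ≫ p = r) (f : X ⟶ Spec (.of k)) :
    pullback r f ⟶ pullback p f :=
  pullback.map r f p f α (𝟙 X) (𝟙 _) (by simp [hα]) (by simp)

theorem isPullback_baseChange (α : E ⟶ C) (hα : α ≫ p = r) (f : X ⟶ Spec (.of k)) :
    IsPullback (baseChange α hα f) (pullback.fst r f) (pullback.fst p f) α := by
  refine IsPullback.of_right (h₁₂ := pullback.snd p f) (v₁₃ := f) (h₂₂ := p) ?_ (by simp)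
    (IsPullback.of_hasPullback p f).flip
  have h : baseChange α hα f ≫ pullback.snd p f = pullback.snd r f := by simp
  rw [h, hα]
  exact (IsPullback.of_hasPullback r f).flip

theorem isPullback_graphHom_comp (α : E ⟶ C) (hα : α ≫ p = r) (φ : C ⟶ X) (hφ : φ ≫ f = p) :
    IsPullback (graphHom (f := f) (α ≫ φ) (by rw [Category.assoc, hφ, hα])) α
      (baseChange α hα f) (graphHom φ hφ) := by
  refine IsPullback.of_right (h₁₂ := pullback.fst r f) (v₁₃ := α) (h₂₂ := pullback.fst p f)
    ?_ ?_ (isPullback_baseChange α hα f).flip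
  · rw [pullback.lift_fst, pullback.lift_fst]
    exact IsPullback.of_horiz_isIso ⟨by simp⟩
  · apply pullback.hom_ext <;> simp

/-- The preimage of the graph of `φᵢ` under the open map `α × X` lies in the graph of `φᵢ ∘ α`, and
open maps pull dense sets back to dense sets. -/
theorem HomOver.dense_iUnion_graph_comp {ι : Type*} (α : HomOver r p) [UniversallyOpen α.1]
    (φ : ι → HomOver p f) (h : Dense (⋃ i, graph (φ i))) :
    Dense (⋃ i, graph (α.comp (φ i))) := by
  have : UniversallyOpen (baseChange α.1 α.2 f) :=
    MorphismProperty.of_isPullback (isPullback_baseChange α.1 α.2 f).flip ‹_›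
  refine (h.preimage (baseChange α.1 α.2 f).isOpenMap).mono ?_
  rw [Set.preimage_iUnion]
  refine Set.iUnion_mono fun i z ⟨c, hc⟩ ↦ ?_
  obtain ⟨x, hx, -⟩ := Scheme.exists_preimage_of_isPullback
    (isPullback_graphHom_comp α.1 α.2 (φ i).1 (φ i).2) z c hc.symm
  exact ⟨x, hx⟩

/-- The map `(id, φ) × Y : E × Y ⟶ E × (X × Y)`. -/
noncomputable abbrev graphProd (φ : E ⟶ X) (hφ : φ ≫ f = r) (g : Y ⟶ Spec (.of k)) :
    pullback r g ⟶ pullback r (pullback.fst f g ≫ f) :=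
  pullback.lift (pullback.fst r g)
    (pullback.lift (pullback.fst r g ≫ φ) (pullback.snd r g)
      (by rw [Category.assoc, hφ, pullback.condition]))
    (by rw [pullback.lift_fst_assoc, Category.assoc, hφ])

/-- The projection `E × (X × Y) ⟶ E × X`. -/
noncomputable abbrev prodProj (r : E ⟶ Spec (.of k)) (f : X ⟶ Spec (.of k))
    (g : Y ⟶ Spec (.of k)) : pullback r (pullback.fst f g ≫ f) ⟶ pullback r f :=
  pullback.map r (pullback.fst f g ≫ f) r f (𝟙 E) (pullback.fst f g) (𝟙 _) (by simp) (by simp)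

theorem isPullback_prodProj (r : E ⟶ Spec (.of k)) (f : X ⟶ Spec (.of k))
    (g : Y ⟶ Spec (.of k)) :
    IsPullback (pullback.snd r (pullback.fst f g ≫ f)) (prodProj r f g) (pullback.fst f g)
      (pullback.snd r f) := by
  refine IsPullback.of_bot (h₃₁ := r) (v₂₁ := pullback.fst r f) (v₂₂ := f) ?_ (by simp)
    (IsPullback.of_hasPullback r f).flip
  have h : prodProj r f g ≫ pullback.fst r f = pullback.fst _ _ := by simp
  rw [h]
  exact (IsPullback.of_hasPullback _ _).flip

theorem isPullback_graphProd (φ : E ⟶ X) (hφ : φ ≫ f = r) (g : Y ⟶ Spec (.of k)) :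
    IsPullback (graphProd φ hφ g) (pullback.fst r g) (prodProj r f g) (graphHom φ hφ) := by
  refine IsPullback.of_right (h₁₂ := pullback.snd r (pullback.fst f g ≫ f))
    (v₁₃ := pullback.fst f g) (h₂₂ := pullback.snd r f) ?_ ?_ (isPullback_prodProj r f g)
  · rw [pullback.lift_snd, pullback.lift_snd]
    refine IsPullback.of_right (h₁₂ := pullback.snd f g) (v₁₃ := g) (h₂₂ := f) ?_ (by simp)
      (IsPullback.of_hasPullback f g).flip
    rw [pullback.lift_snd, hφ]
    exact (IsPullback.of_hasPullback r g).flip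
  · apply pullback.hom_ext <;> simp

theorem graphHom_graphProd (φ : E ⟶ X) (hφ : φ ≫ f = r) (ψ : E ⟶ Y) (hψ : ψ ≫ g = r) :
    graphHom ψ hψ ≫ graphProd φ hφ g = graphHom (pullback.lift φ ψ (hφ.trans hψ.symm))
      (by rw [pullback.lift_fst_assoc, hφ]) := by
  apply pullback.hom_ext
  · simp
  · apply pullback.hom_ext <;> simp

/-- The image of an open `W` in `E × X` meets some graph of `φᵢ`. The part of `E × (X × Y)` over
that graph is a copy of `E × Y`, where `W` restricts to a nonempty open and so meets some graph of
`ψⱼ`. -/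
theorem dense_iUnion_graph_prod {ι κ : Type*} (φ : ι → HomOver r f) (ψ : κ → HomOver r g)
    (hφ : Dense (⋃ i, graph (φ i))) (hψ : Dense (⋃ j, graph (ψ j))) :
    Dense (⋃ ij : ι × κ, graph ((φ ij.1).prod (ψ ij.2))) := by
  rw [dense_iff_inter_open]
  intro W hW hne
  have : UniversallyOpen (prodProj r f g) :=
    MorphismProperty.of_isPullback (isPullback_prodProj r f g) inferInstance
  obtain ⟨_, ⟨w, hw, rfl⟩, hwφ⟩ := hφ.inter_open_nonempty _
    ((prodProj r f g).isOpenMap W hW) (hne.image _)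
  obtain ⟨i, e, he⟩ := Set.mem_iUnion.mp hwφ
  obtain ⟨y, hy, -⟩ := Scheme.exists_preimage_of_isPullback
    (isPullback_graphProd (φ i).1 (φ i).2 g) w e he.symm
  have hyW : graphProd (φ i).1 (φ i).2 g y ∈ W := hy.symm ▸ hw
  obtain ⟨z, hz, hzψ⟩ := hψ.inter_open_nonempty _
    (hW.preimage (graphProd (φ i).1 (φ i).2 g).continuous) ⟨y, hyW⟩
  obtain ⟨j, e', rfl⟩ := Set.mem_iUnion.mp hzψ
  exact ⟨_, hz, Set.mem_iUnion.mpr ⟨(i, j), e',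
    congr($(graphHom_graphProd (φ i).1 (φ i).2 (ψ j).1 (ψ j).2) e').symm⟩⟩

theorem ratPoint_comp_slice (u : RatPoint f) (v : RatPoint g) :
    v.1 ≫ slice f g u = pullback.lift u.1 v.1 (u.2.trans v.2.symm) := by
  obtain ⟨u, hu⟩ := u
  obtain ⟨v, hv⟩ := v
  apply pullback.hom_ext
  · simp [slice, reassoc_of% hv]
  · simp [slice]

/-! ### The product is geometrically special -/

theorem IsGeometricallySpecial.pullback [IsAlgClosed k] [IrreducibleSpace Y]
    (hX : IsGeometricallySpecial f) (hY : IsGeometricallySpecial g) :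
    IsGeometricallySpecial (pullback.fst f g ≫ f) := by
  intro U hU
  have hopen : IsOpenMap (pullback.fst f g) := (pullback.fst f g).isOpenMap
  have hsurj : Function.Surjective (pullback.fst f g) := by
    intro x
    obtain ⟨y⟩ : Nonempty Y := inferInstance
    obtain ⟨z, hz, -⟩ := Scheme.Pullback.exists_preimage_pullback (f := f) (g := g) x y
      (Subsingleton.elim _ _)
    exact ⟨z, hz⟩
  obtain ⟨C, p, c, u, φ, hC, huU, hφu, hφ⟩ := hX ⟨_, hopen U U.isOpen⟩
    (hsurj.denseRange.dense_image (pullback.fst f g).continuous hU)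
  obtain ⟨a⟩ : Nonempty (Spec (CommRingCat.of k)) := inferInstance
  obtain ⟨z, hzU, hz⟩ := huU ⟨a, rfl⟩
  obtain ⟨y, rfl⟩ := exists_slice_apply_eq f g u z ⟨a, hz.symm⟩
  obtain ⟨D, q, d, v, ψ, hD, hvU, hψv, hψ⟩ := hY (slice f g u ⁻¹ᵁ U)
    ((slice f g u ⁻¹ᵁ U).isOpen.dense ⟨y, hzU⟩)
  have := hC.smooth
  have := hD.smooth
  obtain ⟨E, r, e, α, β, hE, _, _, hα, hβ⟩ := exists_curve_etale_over p q c d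
  have hdense := dense_iUnion_graph_prod (fun i ↦ α.comp (φ i)) (fun j ↦ β.comp (ψ j))
    (α.dense_iUnion_graph_comp φ (dense_iff_closure_eq.mpr hφ))
    (β.dense_iUnion_graph_comp ψ (dense_iff_closure_eq.mpr hψ))
  have hv := ratPoint_comp_slice u v
  refine ⟨E, r, e, ⟨v.1 ≫ slice f g u, by rw [hv, pullback.lift_fst_assoc, u.2]⟩,
    -- The pairing bijection of `ℕ × ℕ` with `ℕ` turns the doubly indexed family into a sequence.
    fun n ↦ (α.comp (φ n.unpair.1)).prod (β.comp (ψ n.unpair.2)), hE, ?_, ?_, ?_⟩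
  · rintro _ ⟨b, rfl⟩
    exact hvU ⟨b, rfl⟩
  · intro n
    refine Eq.trans ?_ hv.symm
    apply pullback.hom_ext
    · rw [Category.assoc, pullback.lift_fst]
      exact (congrArg (e.1 ≫ ·) (pullback.lift_fst _ _ _)).trans (by
        simp only [HomOver.comp, reassoc_of% hα, hφu])
    · rw [Category.assoc, pullback.lift_snd]
      exact (congrArg (e.1 ≫ ·) (pullback.lift_snd _ _ _)).trans (by
        simp only [HomOver.comp, reassoc_of% hβ, hψv])
  · rw [← dense_iff_closure_eq]
    refine hdense.mono (Set.iUnion_subset fun ij ↦ ?_)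
    refine Set.subset_iUnion_of_subset (Nat.pair ij.1 ij.2) ?_
    simp only [Nat.unpair_pair, subset_refl]

end GeomSpecial

theorem lemma2p12 {k : Type*} [Field k] [IsAlgClosed k] [CharZero k] {X Y : Scheme}
    (f : X ⟶ Spec (CommRingCat.of k)) (g : Y ⟶ Spec (CommRingCat.of k))
    (hX : GeomSpecial.IsVariety f) (hXs : GeomSpecial.IsGeometricallySpecial f)
    (hY : GeomSpecial.IsVariety g) (hYs : GeomSpecial.IsGeometricallySpecial g) :
    GeomSpecial.IsVariety (pullback.fst f g ≫ f) ∧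
      GeomSpecial.IsGeometricallySpecial (pullback.fst f g ≫ f) := by
  have := hY.integral
  exact ⟨hX.pullback hY, hXs.pullback hYs⟩
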